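/- **Setting.** Let $\mathcal S,\mathcal A$ be finite nonempty sets, $\gamma\in(0,1)$, $\varepsilon\ge 0$, and let $\phi:\mathcal S\times\mathcal A\to\mathbb R^d$ be a feature map whose values span $\mathbb R^d$. An MDP $\mathcal M$ consists of transition probabilities $p_{\mathcal M}(s,a,\cdot)$ on $\mathcal S$ and reward distributions $q_{\mathcal M}(s,a,\cdot)$ on $\mathbb R$, with mean rewards $r_{\mathcal M}(s,a)$. Let $\mathbb M$ be the set of linear MDPs: those whose reward distributions are all absolutely continuous with respect to some measure carried by $[0,1]$ and for which there are $\mu_{\mathcal M}:\mathcal S\to\mathbb R^d$ and $\theta_{\mathcal M}\in\mathbb R^d$ with $p_{\mathcal M}(s,a,s')=\phi(s,a)^\top\mu_{\mathcal M}(s')$ and $r_{\mathcal M}(s,a)=\phi(s,a)^\top\theta_{\mathcal M}$ for all $s,a,s'$. For a policy $\pi:\mathcal S\to\mathcal A$ let $V^\pi_{\mathcal M}(s)=\mathbb E_{\mathcal M}\big[\sum_{t\ge0}\gamma^t r_{\mathcal M}(s_t^\pi,\pi(s_t^\pi))\,\big|\,s_0^\pi=s\big]$. A policy is optimal if its value function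 dominates that of every policy pointwise; $V^\star_{\mathcal M}$ is the value function of an optimal policy, $Q^\star_{\mathcal M}(s,a)=r_{\mathcal M}(s,a)+\gamma\sum_{s'}p_{\mathcal M}(s,a,s')V^\star_{\mathcal M}(s')$, and $\Pi^\star_\varepsilon(\mathcal M)=\{\pi: V^\pi_{\mathcal M}\ge V^\star_{\mathcal M}-\varepsilon \text{ pointwise}\}$. If $\mathcal M$ has a unique optimal policy $\pi^\star_{\mathcal M}$, put $\Delta(\mathcal M)=\min_{s,\,a\ne\pi^\star_{\mathcal M}(s)}\big(V^\star_{\mathcal M}(s)-Q^\star_{\mathcal M}(s,a)\big)$ ($=\infty$ if there is only one action). Write $\mathcal M\ll\mathcal M'$ if $p_{\mathcal M}(s,a,\cdot)\ll p_{\mathcal M'}(s,a,\cdot)$ and $q_{\mathcal M}(s,a,\cdot)\ll q_{\mathcal M'}(s,a,\cdot)$ for all $(s,a)$, and set $$\mathrm{KL}_{\mathcal M|\mathcal M'}(s,a)=\mathrm{KL}\big(q_{\mathcal M}(s,a,\cdot)\,\|\,q_{\mathcal M'}(s,a,\cdot)\big)+\mathrm{KL}\big(p_{\mathcal M}(s,a,\cdot)\,\|\,p_{\mathcal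 M'}(s,a,\cdot)\big),$$ $$\mathrm{Alt}_\varepsilon(\mathcal M)=\{\mathcal M'\in\mathbb M:\ \mathcal M\ll\mathcal M',\ \Pi^\star_\varepsilon(\mathcal M)\cap\Pi^\star_\varepsilon(\mathcal M')=\emptyset\}.$$ For $\omega$ in the simplex $\Sigma_{\mathcal S\times\mathcal A}$ of probability vectors on $\mathcal S\times\mathcal A$ define, with values in $[0,\infty]$, $$T(\mathcal M,\omega)^{-1}=\inf_{\mathcal M'\in\mathrm{Alt}_\varepsilon(\mathcal M)}\sum_{s,a}\omega_{s,a}\,\mathrm{KL}_{\mathcal M|\mathcal M'}(s,a),\qquad T^\star(\mathcal M)^{-1}=\sup_{\omega\in\Sigma_{\mathcal S\times\mathcal A}}T(\mathcal M,\omega)^{-1},$$ and let $\Lambda(\omega)=\sum_{s,a}\omega_{s,a}\phi(s,a)\phi(s,a)^\top$ and $\sigma(\omega)=\max_{s,a}\phi(s,a)^\top\Lambda(\omega)^{-1}\phi(s,a)$, with $\sigma(\omega)=\infty$ if $\Lambda(\omega)$ is singular. **Theorem.** Let $\mathcal M\in\mathbb M$ have a unique optimal policy. Then for every $\omega\in\Sigma_{\mathcal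 S\times\mathcal A}$, $$T(\mathcal M,\omega)\le\frac{10\,\sigma(\omega)}{3(1-\gamma)^4(\Delta(\mathcal M)+\varepsilon)^2},$$ and $$T^\star(\mathcal M)\le\frac{10\,d}{3(1-\gamma)^4(\Delta(\mathcal M)+\varepsilon)^2}.$$ (If $\Delta(\mathcal M)=\infty$, both right-hand sides are read as $0$.) -/

import Mathlib

open MeasureTheory ProbabilityTheory
open scoped ENNReal

/-- An infinite-horizon Markov decision process with state space `S` and action space `A`: the law
`p s a` of the next state and the law `q s a` of the collected reward, for every pair `(s, a)`. -/
structure MDP (S A : Type*) [MeasurableSpace S] where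
  p : S → A → Measure S
  q : S → A → Measure ℝ
  isProb_p : ∀ s a, IsProbabilityMeasure (p s a)
  isProb_q : ∀ s a, IsProbabilityMeasure (q s a)

namespace MDP

noncomputable section

variable {S A : Type*} [Fintype S] [MeasurableSpace S] [DiscreteMeasurableSpace S]

/-- The expected reward `r(s, a)`. -/
def reward (M : MDP S A) (s : S) (a : A) : ℝ := ∫ x, x ∂(M.q s a)

/-- The set of linear MDPs with feature map `φ`: the reward laws are absolutely continuous with
respect to some measure `ν` carried by `[0, 1]`, and `p(s, a, s') = φ(s, a)ᵀ μ(s')` and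
`r(s, a) = φ(s, a)ᵀ θ` for some `μ` and `θ`. -/
def linearMDPs {d : ℕ} (φ : S → A → EuclideanSpace ℝ (Fin d)) :
    Set (MDP S A) :=
  {M | (∃ ν : Measure ℝ, ν (Set.Icc 0 1)ᶜ = 0 ∧ ∀ s a, M.q s a ≪ ν) ∧
    ∃ (μ : S → EuclideanSpace ℝ (Fin d)) (θ : EuclideanSpace ℝ (Fin d)),
      (∀ s a s', (M.p s a).real {s'} = inner ℝ (φ s a) (μ s')) ∧
      (∀ s a, M.reward s a = inner ℝ (φ s a) θ)}

/-- The one-step transition kernel on states under the policy `π : S → A`. -/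
def policyKernel (M : MDP S A) (π : S → A) : Kernel S S where
  toFun s := M.p s (π s)
  measurable' := measurable_of_countable _

instance (M : MDP S A) (π : S → A) : IsMarkovKernel (M.policyKernel π) :=
  ⟨fun s => M.isProb_p s (π s)⟩

/-- The transition at time `n` as a kernel from histories `(s_0, …, s_n)` to the next state; it
only looks at `s_n`. -/
def historyKernel (M : MDP S A) (π : S → A) (n : ℕ) : Kernel (Finset.Iic n → S) S :=
  (M.policyKernel π).comap (fun h => h ⟨n, Finset.mem_Iic.2 le_rfl⟩) (measurable_pi_apply _)

instance (M : MDP S A) (π : S → A) (n : ℕ) : IsMarkovKernel (M.historyKernel π n) := by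
  unfold historyKernel; infer_instance

/-- The law of the state trajectory `(s_t)_{t ≥ 0}` under the policy `π`, started at `s_0 = s`. -/
def trajLaw (M : MDP S A) (π : S → A) (s : S) : Measure (ℕ → S) :=
  Kernel.traj (X := fun _ => S) (M.historyKernel π) 0 (fun _ => s)

/-- The state value function `V^π(s) = E[∑_t γ^t r(s_t, π(s_t)) | s_0 = s]`. -/
def value (γ : ℝ) (M : MDP S A) (π : S → A) (s : S) : ℝ :=
  ∫ x, ∑' t : ℕ, γ ^ t * M.reward (x t) (π (x t)) ∂(M.trajLaw π s)

/-- A policy is optimal if its value function dominates that of any other policy pointwise. -/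
def IsOptimal (γ : ℝ) (M : MDP S A) (π : S → A) : Prop :=
  ∀ (π' : S → A) (s : S), M.value γ π' s ≤ M.value γ π s

/-- The optimal value function `V⋆`: the value function of any optimal policy
(see `optValue_eq_value`). -/
def optValue (γ : ℝ) (M : MDP S A) (s : S) : ℝ := ⨆ π : S → A, M.value γ π s

theorem optValue_eq_value {γ : ℝ} {M : MDP S A} {π : S → A} (h : M.IsOptimal γ π) (s : S) :
    M.optValue γ s = M.value γ π s :=
  haveI : Nonempty (S → A) := ⟨π⟩
  le_antisymm (ciSup_le fun π' => h π' s)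
    (le_ciSup (f := fun π' => M.value γ π' s)
      ⟨M.value γ π s, by rintro _ ⟨π', rfl⟩; exact h π' s⟩ π)

/-- The optimal state-action value function `Q⋆(s, a) = r(s, a) + γ ∑_{s'} p(s, a, s') V⋆(s')`. -/
def optQ (γ : ℝ) (M : MDP S A) (s : S) (a : A) : ℝ :=
  M.reward s a + γ * ∑ s' : S, (M.p s a).real {s'} * M.optValue γ s'

/-- The set `Π⋆_ε` of `ε`-optimal policies. -/
def epsOptimal (γ ε : ℝ) (M : MDP S A) : Set (S → A) :=
  {π | ∀ s, M.optValue γ s - ε ≤ M.value γ π s}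

/-- The sub-optimality gap `Δ = min_{s, a ≠ π⋆(s)} (V⋆(s) - Q⋆(s, a))`, where `πopt` is the optimal
policy. The differences are nonnegative; the minimum over the empty set (one action) is `∞`. -/
def gap (γ : ℝ) (M : MDP S A) (πopt : S → A) : ℝ≥0∞ :=
  ⨅ (s : S) (a : A) (_ : a ≠ πopt s), ENNReal.ofReal (M.optValue γ s - M.optQ γ s a)

/-- `M ≪ M'`: all transition and reward laws are absolutely continuous. -/
def AbsCont (M M' : MDP S A) : Prop :=
  ∀ s a, M.p s a ≪ M'.p s a ∧ M.q s a ≪ M'.q s a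

/-- The Kullback-Leibler divergence `KL_{M | M'}(s, a)`. -/
def kl (M M' : MDP S A) (s : S) (a : A) : ℝ≥0∞ :=
  InformationTheory.klDiv (M.q s a) (M'.q s a) + InformationTheory.klDiv (M.p s a) (M'.p s a)

/-- The set `Alt_ε(M)` of alternative MDPs. -/
def alt {d : ℕ} (φ : S → A → EuclideanSpace ℝ (Fin d)) (γ ε : ℝ)
    (M : MDP S A) : Set (MDP S A) :=
  {M' | M' ∈ linearMDPs φ ∧ M.AbsCont M' ∧ M.epsOptimal γ ε ∩ M'.epsOptimal γ ε = ∅}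

variable [Fintype A]

/-- The characteristic time `T(M, ω)`, with
`T(M, ω)⁻¹ = inf_{M' ∈ Alt_ε(M)} ∑_{s, a} ω_{s, a} KL_{M | M'}(s, a)`. -/
def charTime {d : ℕ} (φ : S → A → EuclideanSpace ℝ (Fin d)) (γ ε : ℝ)
    (M : MDP S A) (ω : S × A → ℝ) : ℝ≥0∞ :=
  (⨅ M' ∈ alt φ γ ε M, ∑ x : S × A, ENNReal.ofReal (ω x) * M.kl M' x.1 x.2)⁻¹

/-- The characteristic time `T⋆(M)`, with `T⋆(M)⁻¹ = sup_ω T(M, ω)⁻¹` over the simplex. -/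
def optCharTime {d : ℕ} (φ : S → A → EuclideanSpace ℝ (Fin d)) (γ ε : ℝ)
    (M : MDP S A) : ℝ≥0∞ :=
  (⨆ ω ∈ stdSimplex ℝ (S × A), (charTime φ γ ε M ω)⁻¹)⁻¹

end

end MDP

noncomputable section

/-- The feature matrix `Λ(ω) = ∑_{s, a} ω_{s, a} φ(s, a) φ(s, a)ᵀ`. -/
def featureMatrix {S A : Type*} [Fintype S] [Fintype A] {d : ℕ}
    (φ : S → A → EuclideanSpace ℝ (Fin d)) (ω : S × A → ℝ) : Matrix (Fin d) (Fin d) ℝ :=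
  ∑ x : S × A, ω x • Matrix.vecMulVec (φ x.1 x.2).ofLp (φ x.1 x.2).ofLp

/-- `σ(ω) = max_{s, a} ‖φ(s, a)‖²_{Λ(ω)⁻¹}`, equal to `∞` if `Λ(ω)` is singular. -/
def designVariance {S A : Type*} [Fintype S] [Fintype A] {d : ℕ}
    (φ : S → A → EuclideanSpace ℝ (Fin d)) (ω : S × A → ℝ) : ℝ≥0∞ :=
  if (featureMatrix φ ω).det = 0 then ∞
  else ⨆ x : S × A, ENNReal.ofReal
    ((φ x.1 x.2).ofLp ⬝ᵥ Matrix.mulVec (featureMatrix φ ω)⁻¹ (φ x.1 x.2).ofLp)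

end

/-! Let `M'` be an alternative and let δ(s, a) be the difference of the Bellman operators of `M` and
`M'` at V⋆ of `M`. Three facts about δ give the bound.

Stability (`gap_add_le`): if |δ| ≤ η, then Δ + ε ≤ 2η/(1 - γ), because the optimal policy of `M` is
not ε-optimal in `M'`.

Information (`sq_optQ_sub_le_kl`): Pinsker's inequality for the rewards and for (1 - γ)V⋆, both with
values in [0, 1], gives 2(1 - γ)²δ² ≤ KL.

Linearity (`exists_optQ_sub_eq_inner`): δ(s, a) = ⟨φ(s, a), w⟩, so Cauchy–Schwarz in the Λ(ω) norm
gives max δ² ≤ σ(ω) ∑ ω δ².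

Together, (1 - γ)⁴(Δ + ε)² ≤ 2 σ(ω) ∑ ω KL, which is stronger than the constant 10/3. The bound on
T⋆ follows by choosing a Kiefer–Wolfowitz design, for which σ(ω) ≤ d. -/

/-! ### Information inequalities -/

/-- The Donsker–Varadhan inequality, for a function with a finite exponential moment. -/
theorem integral_le_toReal_klDiv_add_log {α : Type*} [MeasurableSpace α] {P Q : Measure α}
    [IsProbabilityMeasure P] [IsProbabilityMeasure Q] {f : α → ℝ}
    (hPQ : P ≪ Q) (hint : Integrable (llr P Q) P) (hfP : Integrable f P)
    (hfQ : Integrable (fun x => Real.exp (f x)) Q) :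
    ∫ x, f x ∂P ≤ (InformationTheory.klDiv P Q).toReal + Real.log (∫ x, Real.exp (f x) ∂Q) := by
  have : IsProbabilityMeasure (Q.tilted f) := isProbabilityMeasure_tilted hfQ
  -- Gibbs' inequality for `P` against `Q` tilted by `f`.
  have h1 := InformationTheory.integral_llr_add_sub_measure_univ_nonneg
    (hPQ.trans (absolutelyContinuous_tilted hfQ)) (integrable_llr_tilted_right hPQ hfP hint hfQ)
  rw [integral_llr_tilted_right hPQ hfP hfQ hint] at h1
  rw [InformationTheory.toReal_klDiv_of_measure_eq hPQ (by simp)]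
  simp at h1
  linarith

/-- Pinsker's inequality, for the expectations of a random variable with values in `[0, 1]`. -/
theorem two_mul_sq_integral_sub_le_klDiv {α : Type*} [MeasurableSpace α] {P Q : Measure α}
    [IsProbabilityMeasure P] [IsProbabilityMeasure Q] {f : α → ℝ} (hf : Measurable f)
    (hPQ : P ≪ Q) (hfQ : ∀ᵐ x ∂Q, f x ∈ Set.Icc (0 : ℝ) 1) :
    ENNReal.ofReal (2 * (∫ x, f x ∂P - ∫ x, f x ∂Q) ^ 2) ≤ InformationTheory.klDiv P Q := by
  by_cases hint : Integrable (llr P Q) P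
  swap
  · simp [InformationTheory.klDiv_of_not_integrable hint]
  have hfP : ∀ᵐ x ∂P, f x ∈ Set.Icc (0 : ℝ) 1 := hPQ.ae_le hfQ
  have hIP : Integrable f P := Integrable.of_mem_Icc 0 1 hf.aemeasurable hfP
  have hsub := hasSubgaussianMGF_of_mem_Icc hf.aemeasurable hfQ
  set m := ∫ x, f x ∂Q
  set δ := ∫ x, f x ∂P - m with hδ
  -- By Hoeffding's lemma KL ≥ λδ - λ²/8 for every λ; the maximum, 2δ², is at λ = 4δ.
  have hexp := hsub.integrable_exp_mul (4 * δ)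
  have h1 := integral_le_toReal_klDiv_add_log hPQ hint
    ((hIP.sub (integrable_const m)).const_mul (4 * δ)) hexp
  have h2 : Real.log (∫ x, Real.exp (4 * δ * (f x - m)) ∂Q) ≤ 2 * δ ^ 2 := by
    have h3 := hsub.mgf_le (4 * δ)
    rw [mgf] at h3
    have hpos : 0 < ∫ x, Real.exp (4 * δ * (f x - m)) ∂Q := integral_exp_pos hexp
    refine (Real.log_le_log hpos h3).trans ?_
    rw [Real.log_exp]
    norm_num
    nlinarith [sq_nonneg δ]
  simp only [Pi.sub_apply] at h1
  rw [integral_const_mul, integral_sub hIP (integrable_const m)] at h1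
  simp only [integral_const, probReal_univ, smul_eq_mul, one_mul] at h1
  rw [← hδ] at h1
  refine ENNReal.ofReal_le_of_le_toReal ?_
  nlinarith

/-! ### Trajectory expectations and the Bellman equation -/

theorem ProbabilityTheory.Kernel.map_traj_apply_succ {X : ℕ → Type*}
    [∀ n, MeasurableSpace (X n)]
    (κ : (n : ℕ) → Kernel ((i : Finset.Iic n) → X i) (X (n + 1))) [∀ n, IsMarkovKernel (κ n)]
    {a b : ℕ} (hab : a ≤ b) :
    (Kernel.traj κ a).map (fun x => x (b + 1)) = κ b ∘ₖ Kernel.partialTraj κ a b := by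
  rw [← Kernel.traj_comp_partialTraj hab, Kernel.map_comp, Kernel.map_traj_succ_self]

/-- The mean of a function of the state at time `b + 1`, given by the kernel at time `b`. -/
theorem ProbabilityTheory.Kernel.integral_traj_succ {X : ℕ → Type*} [∀ n, MeasurableSpace (X n)]
    (κ : (n : ℕ) → Kernel ((i : Finset.Iic n) → X i) (X (n + 1))) [∀ n, IsMarkovKernel (κ n)]
    {a b : ℕ} (u : (i : Finset.Iic a) → X i) {g : X (b + 1) → ℝ} (hm : Measurable g) (hab : a ≤ b)
    (hg : Integrable g ((κ b ∘ₖ Kernel.partialTraj κ a b) u)) :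
    ∫ x, g (x (b + 1)) ∂(Kernel.traj κ a u) =
      ∫ x, ∫ y, g y ∂(κ b (Preorder.frestrictLe b x)) ∂(Kernel.traj κ a u) := by
  calc ∫ x, g (x (b + 1)) ∂(Kernel.traj κ a u)
      = ∫ y, g y ∂((Kernel.traj κ a).map (fun x => x (b + 1)) u) := by
        rw [Kernel.map_apply _ (by fun_prop), integral_map (measurable_pi_apply _).aemeasurable
          hm.aestronglyMeasurable]
    _ = ∫ h, ∫ y, g y ∂(κ b h) ∂(Kernel.partialTraj κ a b u) := by
        rw [Kernel.map_traj_apply_succ κ hab, Kernel.integral_comp hg]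
    _ = _ := by
        rw [← Kernel.traj_map_frestrictLe, Kernel.map_apply _ (by fun_prop),
          integral_map (by fun_prop)
            (hm.stronglyMeasurable.integral_kernel).aestronglyMeasurable]

namespace MDP

variable {S A : Type*} [Fintype S] [MeasurableSpace S] [DiscreteMeasurableSpace S]

theorem sum_p_real (M : MDP S A) (s : S) (a : A) : ∑ s', (M.p s a).real {s'} = 1 := by
  have := M.isProb_p s a
  rw [← probReal_univ (μ := M.p s a), ← Finset.coe_univ, ← sum_measureReal_singleton]

theorem integral_p (M : MDP S A) (s : S) (a : A) (f : S → ℝ) :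
    ∫ s', f s' ∂(M.p s a) = ∑ s', (M.p s a).real {s'} * f s' := by
  have := M.isProb_p s a
  rw [integral_fintype (Integrable.of_finite)]
  simp

/-- The expectation of `g` at the next state, as a function of the current state. -/
def nextMean (M : MDP S A) (π : S → A) (g : S → ℝ) (s : S) : ℝ :=
  ∑ s', (M.p s (π s)).real {s'} * g s'

instance (M : MDP S A) (π : S → A) (s : S) : IsProbabilityMeasure (M.trajLaw π s) := by
  unfold trajLaw; infer_instance

theorem integral_trajLaw_zero (M : MDP S A) (π : S → A) (s : S) (g : S → ℝ) :
    ∫ x, g (x 0) ∂(M.trajLaw π s) = g s := by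
  have h : (M.trajLaw π s).map (Preorder.frestrictLe 0) = Measure.dirac (fun _ => s) := by
    rw [trajLaw, Kernel.traj_map_frestrictLe_apply, Kernel.partialTraj_self, Kernel.id_apply]
  have h2 : ∫ x, g (x 0) ∂(M.trajLaw π s) = ∫ y, g (y ⟨0, Finset.mem_Iic.2 le_rfl⟩)
      ∂((M.trajLaw π s).map (Preorder.frestrictLe (π := fun _ => S) 0)) := by
    rw [integral_map (by fun_prop) (by exact (Measurable.of_discrete).aestronglyMeasurable)]
    rfl
  rw [h2, h, integral_dirac]

theorem integral_trajLaw_succ (M : MDP S A) (π : S → A) (s : S) (g : S → ℝ) (t : ℕ) :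
    ∫ x, g (x (t + 1)) ∂(M.trajLaw π s) = ∫ x, M.nextMean π g (x t) ∂(M.trajLaw π s) := by
  refine (Kernel.integral_traj_succ (X := fun _ => S) (M.historyKernel π) _ (g := g)
    Measurable.of_discrete (Nat.zero_le t) Integrable.of_finite).trans ?_
  exact integral_congr_ae (.of_forall fun x => M.integral_p _ _ g)

theorem integral_trajLaw (M : MDP S A) (π : S → A) (s : S) (g : S → ℝ) (t : ℕ) :
    ∫ x, g (x t) ∂(M.trajLaw π s) = (M.nextMean π)^[t] g s := by
  induction t generalizing g with
  | zero => exact M.integral_trajLaw_zero π s g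
  | succ t ih => rw [integral_trajLaw_succ, ih, Function.iterate_succ_apply]

theorem hasSum_value {γ : ℝ} (hγ0 : 0 ≤ γ) (hγ1 : γ < 1) (M : MDP S A) (π : S → A) (s : S) :
    HasSum (fun t : ℕ => γ ^ t * (M.nextMean π)^[t] (fun s => M.reward s (π s)) s)
      (M.value γ π s) := by
  obtain ⟨c, hc⟩ : ∃ c, ∀ s, |M.reward s (π s)| ≤ c := by
    obtain ⟨c, hc⟩ := (Set.finite_range fun s => |M.reward s (π s)|).bddAbove
    exact ⟨c, fun s => hc ⟨s, rfl⟩⟩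
  have hm : ∀ t, AEStronglyMeasurable
      (fun x : ℕ → S => γ ^ t * M.reward (x t) (π (x t))) (M.trajLaw π s) := fun t =>
    ((Measurable.of_discrete (f := fun s => γ ^ t * M.reward s (π s))).comp
      (measurable_pi_apply t)).aestronglyMeasurable
  have hb : ∀ t (x : ℕ → S), ‖γ ^ t * M.reward (x t) (π (x t))‖ ≤ γ ^ t * c := fun t x => by
    rw [norm_mul, norm_pow, Real.norm_of_nonneg hγ0]
    gcongr
    exact hc _
  have hs : Summable fun t : ℕ => γ ^ t * c := (summable_geometric_of_lt_one hγ0 hγ1).mul_right c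
  -- Rewards are bounded by `c` on the finite state space, so a geometric series dominates and the
  -- sum and expectation can be exchanged.
  have := hasSum_integral_of_dominated_convergence (μ := M.trajLaw π s)
    (F := fun t x => γ ^ t * M.reward (x t) (π (x t)))
    (f := fun x => ∑' t : ℕ, γ ^ t * M.reward (x t) (π (x t)))
    (fun t _ => γ ^ t * c) hm (fun t => .of_forall (hb t)) (.of_forall fun _ => hs)
    (integrable_const _) (.of_forall fun x => (Summable.of_norm_bounded hs fun t => hb t x).hasSum)
  simp_rw [integral_const_mul, M.integral_trajLaw π s (fun s => M.reward s (π s))] at this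
  exact this

/-- The Bellman equation of a policy. -/
theorem value_eq {γ : ℝ} (hγ0 : 0 ≤ γ) (hγ1 : γ < 1) (M : MDP S A) (π : S → A) (s : S) :
    M.value γ π s = M.reward s (π s) + γ * ∑ s', (M.p s (π s)).real {s'} * M.value γ π s' := by
  have h := M.hasSum_value hγ0 hγ1 π s
  have h1 := h.tsum_eq
  rw [h.summable.tsum_eq_zero_add] at h1
  have h2 : HasSum (fun t : ℕ => γ ^ (t + 1) *
      (M.nextMean π)^[t + 1] (fun s => M.reward s (π s)) s)
      (γ * ∑ s', (M.p s (π s)).real {s'} * M.value γ π s') := by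
    have := (hasSum_sum fun s' (_ : s' ∈ Finset.univ) =>
      (M.hasSum_value hγ0 hγ1 π s').mul_left ((M.p s (π s)).real {s'})).mul_left γ
    convert! this using 2 with t
    rw [Function.iterate_succ_apply', nextMean, pow_succ', mul_assoc, Finset.mul_sum]
    congr 1
    exact Finset.sum_congr rfl fun _ _ => by ring
  rw [h2.tsum_eq] at h1
  rw [← h1]
  simp

end MDP

/-! ### Value bounds and stability of the gap -/

namespace MDP

theorem reward_mem_Icc {S A : Type*} [MeasurableSpace S] {d : ℕ} {φ : S → A → EuclideanSpace ℝ (Fin d)} {M : MDP S A}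
    (hM : M ∈ linearMDPs φ) (s : S) (a : A) :
    (∀ᵐ x ∂(M.q s a), x ∈ Set.Icc (0 : ℝ) 1) ∧ M.reward s a ∈ Set.Icc (0 : ℝ) 1 := by
  obtain ⟨⟨ν, hν, hq⟩, -⟩ := hM
  have := M.isProb_q s a
  have h : ∀ᵐ x ∂(M.q s a), x ∈ Set.Icc (0 : ℝ) 1 := hq s a hν
  refine ⟨h, integral_nonneg_of_ae (h.mono fun x hx => hx.1), ?_⟩
  calc ∫ x, x ∂(M.q s a) ≤ ∫ _, (1 : ℝ) ∂(M.q s a) :=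
        integral_mono_ae (Integrable.of_mem_Icc 0 1 aemeasurable_id h) (integrable_const _)
          (h.mono fun x hx => hx.2)
    _ = 1 := by simp

variable {S A : Type*} [Fintype S] [MeasurableSpace S] [DiscreteMeasurableSpace S]

theorem sum_p_mul_le (M : MDP S A) (s : S) (a : A) {f : S → ℝ} {c : ℝ} (hf : ∀ s, f s ≤ c) :
    ∑ s', (M.p s a).real {s'} * f s' ≤ c := by
  calc ∑ s', (M.p s a).real {s'} * f s' ≤ ∑ s', (M.p s a).real {s'} * c := by
        gcongr; exact hf _
    _ = c := by rw [← Finset.sum_mul, sum_p_real, one_mul]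

/-- A function on states that exceeds its discounted mean at the next state by at most `(1 - γ) c`
is at most `c`. -/
theorem le_of_le_add_mul_sum {γ : ℝ} (hγ0 : 0 ≤ γ) (hγ1 : γ < 1) (M : MDP S A) (π : S → A)
    {f : S → ℝ} {c : ℝ}
    (hf : ∀ s, f s ≤ (1 - γ) * c + γ * ∑ s', (M.p s (π s)).real {s'} * f s') (s : S) :
    f s ≤ c := by
  have : Nonempty S := ⟨s⟩
  -- At a maximizer the hypothesis reads f(s₀) ≤ (1 - γ)c + γ f(s₀).
  obtain ⟨s₀, hs₀⟩ := Finite.exists_max f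
  have h1 := (hf s₀).trans (add_le_add_right
    (mul_le_mul_of_nonneg_left (M.sum_p_mul_le s₀ (π s₀) hs₀) hγ0) _)
  have h2 : f s₀ ≤ c := by nlinarith
  exact (hs₀ s).trans h2

/-- Rewards lie in [0, 1], so the maximum principle `le_of_le_add_mul_sum` applies to -V with c = 0
and to V with c = 1/(1 - γ). This range is what Pinsker's inequality for the transitions needs. -/
theorem value_mem_Icc {d : ℕ} {φ : S → A → EuclideanSpace ℝ (Fin d)} {γ : ℝ} (hγ0 : 0 ≤ γ)
    (hγ1 : γ < 1) {M : MDP S A} (hM : M ∈ linearMDPs φ) (π : S → A) (s : S) :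
    (1 - γ) * M.value γ π s ∈ Set.Icc (0 : ℝ) 1 := by
  have hγ : 0 < 1 - γ := by linarith
  constructor
  · have : -M.value γ π s ≤ 0 := by
      refine M.le_of_le_add_mul_sum hγ0 hγ1 π (f := fun s => -M.value γ π s) (fun s => ?_) s
      rw [M.value_eq hγ0 hγ1 π s]
      simp only [mul_neg, Finset.sum_neg_distrib]
      linarith [(reward_mem_Icc hM s (π s)).2.1]
    nlinarith
  · have : M.value γ π s ≤ 1 / (1 - γ) := by
      refine M.le_of_le_add_mul_sum hγ0 hγ1 π (fun s => ?_) s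
      rw [mul_one_div_cancel hγ.ne']
      conv_lhs => rw [M.value_eq hγ0 hγ1 π s]
      linarith [(reward_mem_Icc hM s (π s)).2.2]
    rwa [le_div_iff₀' hγ] at this

/-- The Bellman optimality inequality. -/
theorem optQ_le_value {γ : ℝ} (hγ0 : 0 ≤ γ) (hγ1 : γ < 1) {M : MDP S A} {πopt : S → A}
    (hopt : M.IsOptimal γ πopt) (s : S) (a : A) : M.optQ γ s a ≤ M.value γ πopt s := by
  classical
  by_contra! hlt
  simp only [optQ, optValue_eq_value hopt] at hlt
  -- Policy improvement: deviating to `a` at `s` alone would lose nowhere and gain strictly at `s`.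
  set π := Function.update πopt s a with hπ
  have step : ∀ s', M.value γ πopt s' ≤
      M.reward s' (π s') + γ * ∑ s'', (M.p s' (π s')).real {s''} * M.value γ πopt s'' := by
    intro s'
    by_cases h : s' = s
    · subst h; simpa [hπ] using hlt.le
    · simpa [hπ, h] using (M.value_eq hγ0 hγ1 πopt s').le
  have hle : ∀ s', M.value γ πopt s' - M.value γ π s' ≤ 0 := by
    refine M.le_of_le_add_mul_sum hγ0 hγ1 π fun s' => ?_
    have := step s'
    rw [M.value_eq hγ0 hγ1 π s']
    simp only [mul_sub, Finset.sum_sub_distrib]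
    linarith
  have h2 := M.value_eq hγ0 hγ1 π s
  rw [show π s = a by simp [hπ]] at h2
  have h3 : ∑ s', (M.p s a).real {s'} * M.value γ πopt s' ≤
      ∑ s', (M.p s a).real {s'} * M.value γ π s' := by
    gcongr with s'
    linarith [hle s']
  have h4 := hopt π s
  nlinarith

/-- If the Bellman operators of `M'` and `M` differ by at most `η` at `V⋆_M`, then an `M'` in which
the optimal policy of `M` is not `ε`-optimal has `Δ(M) + ε ≤ 2 η / (1 - γ)`. -/
theorem gap_add_le {γ ε η : ℝ} (hγ0 : 0 < γ) (hγ1 : γ < 1) (hε : 0 ≤ ε) [Finite A]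
    {M M' : MDP S A} {πopt : S → A} (hopt : M.IsOptimal γ πopt)
    (hη : ∀ s a, |M.optQ γ s a -
      (M'.reward s a + γ * ∑ s', (M'.p s a).real {s'} * M.optValue γ s')| ≤ η)
    (hdisj : M.epsOptimal γ ε ∩ M'.epsOptimal γ ε = ∅) :
    M.gap γ πopt + ENNReal.ofReal ε ≤ ENNReal.ofReal (2 * η / (1 - γ)) := by
  have hγ : 0 < 1 - γ := by linarith
  have hnot : πopt ∉ M'.epsOptimal γ ε := fun h => by
    have h1 : πopt ∈ M.epsOptimal γ ε := fun s => by
      rw [optValue_eq_value hopt]; linarith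
    have h2 : πopt ∈ M.epsOptimal γ ε ∩ M'.epsOptimal γ ε := ⟨h1, h⟩
    rw [hdisj] at h2
    exact h2
  obtain ⟨s₁, hs₁⟩ : ∃ s, M'.value γ πopt s < M'.optValue γ s - ε := by
    by_contra! h
    exact hnot h
  have : Nonempty (S → A) := ⟨πopt⟩
  -- It is enough that `π` is best at the single state `s₁`; no optimal policy of `M'` is needed.
  obtain ⟨π, hπ⟩ := exists_eq_ciSup_of_finite (f := fun π => M'.value γ π s₁)
  rw [optValue, ← hπ] at hs₁
  have : Nonempty S := ⟨s₁⟩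
  -- At the state of largest advantage the two policies must differ: a common action would bound
  -- this positive maximum by γ times itself.
  obtain ⟨s, hs⟩ := Finite.exists_max fun s => M'.value γ π s - M'.value γ πopt s
  have hgt : ε < M'.value γ π s - M'.value γ πopt s := by linarith [hs s₁]
  simp only [optQ, optValue_eq_value hopt] at hη
  have hup : ∀ s', M'.value γ π s' - M.value γ πopt s' ≤ η / (1 - γ) := by
    refine M'.le_of_le_add_mul_sum hγ0.le hγ1 π fun s' => ?_
    have h1 := (abs_le.1 (hη s' (π s'))).1
    have h2 := optQ_le_value hγ0.le hγ1 hopt s' (π s')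
    simp only [optQ, optValue_eq_value hopt] at h2
    rw [M'.value_eq hγ0.le hγ1 π s', mul_div_cancel₀ _ hγ.ne']
    simp only [mul_sub, Finset.sum_sub_distrib]
    linarith
  have hlow : ∀ s', M.value γ πopt s' - M'.value γ πopt s' ≤ η / (1 - γ) := by
    refine M'.le_of_le_add_mul_sum hγ0.le hγ1 πopt fun s' => ?_
    have h1 := (abs_le.1 (hη s' (πopt s'))).2
    have h2 := M.value_eq hγ0.le hγ1 πopt s'
    have h3 := M'.value_eq hγ0.le hγ1 πopt s'
    rw [mul_div_cancel₀ _ hγ.ne']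
    simp only [mul_sub, Finset.sum_sub_distrib]
    linarith
  have hne : π s ≠ πopt s := fun h => by
    have h1 := M'.value_eq hγ0.le hγ1 π s
    have h2 := M'.value_eq hγ0.le hγ1 πopt s
    have h3 := M'.sum_p_mul_le s (πopt s) hs
    simp only [mul_sub, Finset.sum_sub_distrib] at h3
    rw [h] at h1
    nlinarith
  -- One η/(1 - γ) comes from `hlow`; the other is η + γη/(1 - γ), from one Bellman step followed by
  -- `hup`.
  have hfin : M.optValue γ s - M.optQ γ s (π s) + ε ≤ 2 * η / (1 - γ) := by
    simp only [optQ, optValue_eq_value hopt]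
    have h1 := M'.value_eq hγ0.le hγ1 π s
    have h2 := hlow s
    have h3 := M'.sum_p_mul_le s (π s) hup
    have h4 := (abs_le.1 (hη s (π s))).1
    simp only [mul_sub, Finset.sum_sub_distrib] at h3
    have h5 := mul_le_mul_of_nonneg_left h3 hγ0.le
    have h6 : η = (1 - γ) * (η / (1 - γ)) := (mul_div_cancel₀ _ hγ.ne').symm
    rw [mul_div_assoc]
    linarith
  have hnn : 0 ≤ M.optValue γ s - M.optQ γ s (π s) := by
    rw [optValue_eq_value hopt]
    exact sub_nonneg.2 (optQ_le_value hγ0.le hγ1 hopt s (π s))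
  calc M.gap γ πopt + ENNReal.ofReal ε
      ≤ ENNReal.ofReal (M.optValue γ s - M.optQ γ s (π s)) + ENNReal.ofReal ε := by
        gcongr
        exact iInf_le_of_le s (iInf₂_le (π s) hne)
    _ = ENNReal.ofReal (M.optValue γ s - M.optQ γ s (π s) + ε) :=
        (ENNReal.ofReal_add hnn hε).symm
    _ ≤ _ := ENNReal.ofReal_le_ofReal hfin

/-- The divergence `KL_{M | M'}` controls the difference of the Bellman operators at `V⋆_M`. -/
theorem sq_optQ_sub_le_kl {d : ℕ} {φ : S → A → EuclideanSpace ℝ (Fin d)} {γ : ℝ} (hγ0 : 0 < γ)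
    (hγ1 : γ < 1) {M M' : MDP S A} (hM : M ∈ linearMDPs φ) (hM' : M' ∈ linearMDPs φ)
    (hac : M.AbsCont M') {πopt : S → A} (hopt : M.IsOptimal γ πopt) (s : S) (a : A) :
    ENNReal.ofReal (2 * (1 - γ) ^ 2 * (M.optQ γ s a -
      (M'.reward s a + γ * ∑ s', (M'.p s a).real {s'} * M.optValue γ s')) ^ 2) ≤
      M.kl M' s a := by
  have := M.isProb_q s a
  have := M'.isProb_q s a
  have := M.isProb_p s a
  have := M'.isProb_p s a
  have hr := two_mul_sq_integral_sub_le_klDiv (f := fun x : ℝ => x) measurable_id (hac s a).2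
    (reward_mem_Icc hM' s a).1
  have hp := two_mul_sq_integral_sub_le_klDiv (f := fun s' => (1 - γ) * M.optValue γ s')
    Measurable.of_discrete (hac s a).1 (.of_forall fun s' => by
      rw [optValue_eq_value hopt]; exact value_mem_Icc hγ0.le hγ1 hM πopt s')
  refine le_trans ?_ (add_le_add hr hp)
  rw [← ENNReal.ofReal_add (by positivity) (by positivity)]
  refine ENNReal.ofReal_le_ofReal ?_
  rw [integral_const_mul, integral_const_mul, integral_p, integral_p, optQ]
  change _ ≤ 2 * (M.reward s a - M'.reward s a) ^ 2 + _
  set u := M.reward s a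
  set u' := M'.reward s a
  set v := ∑ s', (M.p s a).real {s'} * M.optValue γ s'
  set v' := ∑ s', (M'.p s a).real {s'} * M.optValue γ s'
  have hγ : 0 < 1 - γ := by linarith
  -- Convexity of the square, with weights 1 - γ and γ; the weights are then bounded by 1.
  have key : ((1 - γ) * (u - u') + γ * ((1 - γ) * (v - v'))) ^ 2 ≤
      (u - u') ^ 2 + ((1 - γ) * (v - v')) ^ 2 := by
    set x := u - u'
    set y := (1 - γ) * (v - v')
    nlinarith [sq_nonneg (x - y), mul_pos hγ0 hγ, sq_nonneg x, sq_nonneg y,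
      mul_nonneg (mul_pos hγ0 hγ).le (sq_nonneg (x - y)), mul_nonneg hγ.le (sq_nonneg y),
      mul_nonneg hγ0.le (sq_nonneg x)]
  linarith

end MDP

/-! ### Optimal design -/

section Design

open Matrix

variable {S A : Type*} [Fintype S] [Fintype A] {d : ℕ} (φ : S → A → EuclideanSpace ℝ (Fin d))

theorem dotProduct_featureMatrix_mulVec (ω : S × A → ℝ) (v w : Fin d → ℝ) :
    v ⬝ᵥ featureMatrix φ ω *ᵥ w =
      ∑ x : S × A, ω x * (((φ x.1 x.2).ofLp ⬝ᵥ v) * ((φ x.1 x.2).ofLp ⬝ᵥ w)) := by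
  rw [featureMatrix, Matrix.sum_mulVec, dotProduct_sum]
  refine Finset.sum_congr rfl fun x _ => ?_
  rw [smul_mulVec, dotProduct_smul, vecMulVec_mulVec]
  simp [dotProduct_comm v, mul_comm]

/-- Cauchy–Schwarz in the form `⟨φ(x), w⟩² ≤ ‖φ(x)‖²_{Λ(ω)⁻¹} ‖w‖²_{Λ(ω)}`. -/
theorem sq_dotProduct_le_mul_sum {ω : S × A → ℝ} (hω : ∀ x, 0 ≤ ω x)
    (hdet : (featureMatrix φ ω).det ≠ 0) (u w : Fin d → ℝ) :
    (u ⬝ᵥ w) ^ 2 ≤ (u ⬝ᵥ (featureMatrix φ ω)⁻¹ *ᵥ u) *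
      ∑ x : S × A, ω x * ((φ x.1 x.2).ofLp ⬝ᵥ w) ^ 2 := by
  set Λ := featureMatrix φ ω
  -- With u = Λv, both u·w and u·Λ⁻¹u become ω-weighted sums over the features.
  set v := Λ⁻¹ *ᵥ u
  have hv : Λ *ᵥ v = u := by
    rw [mulVec_mulVec, mul_nonsing_inv _ (isUnit_iff_ne_zero.2 hdet), one_mulVec]
  have h1 : u ⬝ᵥ w = ∑ x : S × A, ω x * (((φ x.1 x.2).ofLp ⬝ᵥ w) * ((φ x.1 x.2).ofLp ⬝ᵥ v)) := by
    rw [← dotProduct_featureMatrix_mulVec, hv, dotProduct_comm]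
  have h2 : u ⬝ᵥ v = ∑ x : S × A, ω x * (((φ x.1 x.2).ofLp ⬝ᵥ v) * ((φ x.1 x.2).ofLp ⬝ᵥ v)) := by
    rw [← dotProduct_featureMatrix_mulVec, hv, dotProduct_comm]
  rw [h1, h2]
  refine Finset.sum_sq_le_sum_mul_sum_of_sq_le_mul _ (fun x _ => ?_) (fun x _ => ?_)
    fun x _ => by apply le_of_eq; ring
  · exact mul_nonneg (hω x) (mul_self_nonneg _)
  · exact mul_nonneg (hω x) (sq_nonneg _)

/-- If σ(ω) were 0, Cauchy–Schwarz with u = w = φ(s, a) would force φ(s, a) = 0. Nonvanishing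
excludes the product 0 · ∞ = 0 in the final bound. -/
theorem designVariance_ne_zero {s : S} {a : A} (h : φ s a ≠ 0) {ω : S × A → ℝ}
    (hω : ∀ x, 0 ≤ ω x) : designVariance φ ω ≠ 0 := by
  intro h0
  rw [designVariance] at h0
  split_ifs at h0 with hdet
  · exact ENNReal.top_ne_zero h0
  have h1 := ENNReal.ofReal_eq_zero.1 (ENNReal.iSup_eq_zero.1 h0 (s, a))
  have h2 := sq_dotProduct_le_mul_sum φ hω hdet (φ s a).ofLp (φ s a).ofLp
  have h3 : 0 ≤ ∑ x : S × A, ω x * ((φ x.1 x.2).ofLp ⬝ᵥ (φ s a).ofLp) ^ 2 :=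
    Finset.sum_nonneg fun x _ => mul_nonneg (hω x) (sq_nonneg _)
  have h4 : ((φ s a).ofLp ⬝ᵥ (φ s a).ofLp) ^ 2 ≤ 0 :=
    h2.trans (mul_nonpos_of_nonpos_of_nonneg h1 h3)
  have h5 : (φ s a).ofLp ⬝ᵥ (φ s a).ofLp = 0 := by
    exact pow_eq_zero_iff two_ne_zero |>.1 (le_antisymm h4 (sq_nonneg _))
  exact h (by ext i; simpa using congrFun (dotProduct_self_eq_zero.1 h5) i)

/-- A null vector of the quadratic form is orthogonal to every feature, hence to their span. -/
theorem featureMatrix_det_pos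
    (hφ : Submodule.span ℝ (Set.range fun x : S × A => φ x.1 x.2) = ⊤) {ω : S × A → ℝ}
    (hω : ∀ x, 0 < ω x) : 0 < (featureMatrix φ ω).det := by
  refine PosDef.det_pos (.of_dotProduct_mulVec_pos ?_ fun v hv => ?_)
  · ext i j
    simp [featureMatrix, Matrix.sum_apply, vecMulVec_apply, mul_comm]
  rw [star_trivial, dotProduct_featureMatrix_mulVec]
  have hnn : ∀ x : S × A, 0 ≤ ω x * (((φ x.1 x.2).ofLp ⬝ᵥ v) * ((φ x.1 x.2).ofLp ⬝ᵥ v)) :=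
    fun x => mul_nonneg (hω x).le (mul_self_nonneg _)
  refine lt_of_le_of_ne (Finset.sum_nonneg fun x _ => hnn x) fun h0 => hv ?_
  have h1 : ∀ x : S × A, (φ x.1 x.2).ofLp ⬝ᵥ v = 0 := fun x => by
    have := (Finset.sum_eq_zero_iff_of_nonneg fun x _ => hnn x).1 h0.symm x (Finset.mem_univ x)
    simpa [(hω x).ne'] using this
  have h2 : ∀ y ∈ Submodule.span ℝ (Set.range fun x : S × A => φ x.1 x.2), y.ofLp ⬝ᵥ v = 0 := by
    intro y hy
    induction hy using Submodule.span_induction with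
    | mem y hy => obtain ⟨x, rfl⟩ := hy; exact h1 x
    | zero => simp
    | add y z _ _ hy hz => simp [add_dotProduct, hy, hz]
    | smul c y _ hy => simp [smul_dotProduct, hy]
  exact dotProduct_self_eq_zero.1 (h2 (WithLp.toLp 2 v) (hφ ▸ Submodule.mem_top))

/-- If `1 + u g ≤ (1 + u) ^ d` for all `u > 0` then `g ≤ d`. -/
theorem le_of_one_add_mul_le_pow {g : ℝ} {d : ℕ} (h : ∀ u > 0, 1 + u * g ≤ (1 + u) ^ d) :
    g ≤ d := by
  have hd : HasDerivAt (fun u : ℝ => (1 + u) ^ d) (d : ℝ) 0 := by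
    simpa using ((hasDerivAt_id' (0 : ℝ)).const_add 1).fun_pow d
  have ht := hd.tendsto_slope_zero_right
  refine ge_of_tendsto ht (eventually_nhdsWithin_of_forall fun u hu => ?_)
  have hu : 0 < u := hu
  simp only [zero_add, add_zero, one_pow, smul_eq_mul]
  rw [le_inv_mul_iff₀ hu]
  linarith [h u hu]

/-- The Kiefer–Wolfowitz theorem: a design that maximizes `det Λ(ω)` has `σ(ω) ≤ d`. -/
theorem exists_designVariance_le [Nonempty S] [Nonempty A]
    (hφ : Submodule.span ℝ (Set.range fun x : S × A => φ x.1 x.2) = ⊤) :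
    ∃ ω ∈ stdSimplex ℝ (S × A), designVariance φ ω ≤ d := by
  classical
  have hcont : Continuous fun ω : S × A → ℝ => (featureMatrix φ ω).det := by
    unfold featureMatrix; fun_prop
  have hunif : (fun _ => (Fintype.card (S × A) : ℝ)⁻¹) ∈ stdSimplex ℝ (S × A) :=
    ⟨fun _ => by positivity, by
      rw [Finset.sum_const, Finset.card_univ, nsmul_eq_mul, mul_inv_cancel₀ (by positivity)]⟩
  obtain ⟨ω, hω, hmax⟩ := (isCompact_stdSimplex ℝ (S × A)).exists_isMaxOn ⟨_, hunif⟩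
    hcont.continuousOn
  have hpos : 0 < (featureMatrix φ ω).det :=
    (featureMatrix_det_pos φ hφ fun _ => by positivity).trans_le (hmax hunif)
  refine ⟨ω, hω, ?_⟩
  rw [designVariance, if_neg hpos.ne']
  refine iSup_le fun x => ENNReal.ofReal_le_of_le_toReal ?_
  rw [ENNReal.toReal_natCast]
  refine le_of_one_add_mul_le_pow fun u hu => ?_
  have hu1 : 0 < 1 + u := by linarith
  set f := (φ x.1 x.2).ofLp with hf
  -- Mass `u` is added at `x` and the design renormalized. The matrix determinant lemma gives the
  -- factor 1 + u φᵀΛ⁻¹φ, the normalization gives (1 + u)^d, and maximality compares them.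
  set ω' : S × A → ℝ := (1 + u)⁻¹ • (ω + u • Pi.single x 1) with hω'
  have hmem : ω' ∈ stdSimplex ℝ (S × A) := by
    refine ⟨fun y => mul_nonneg (by positivity) (add_nonneg (hω.1 y) (mul_nonneg hu.le ?_)), ?_⟩
    · by_cases h : y = x
      · subst h; simp
      · simp [h]
    · simp only [hω', Pi.smul_apply, Pi.add_apply, smul_eq_mul, ← Finset.mul_sum,
        Finset.sum_add_distrib, hω.2]
      simp [hu1.ne']
  have hΛ : featureMatrix φ ω + u • vecMulVec f f = (1 + u) • featureMatrix φ ω' := by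
    have h1 : featureMatrix φ (ω + u • Pi.single x 1) = featureMatrix φ ω + u • vecMulVec f f := by
      simp only [featureMatrix, Pi.add_apply, add_smul, Finset.sum_add_distrib]
      congr 1
      rw [Finset.sum_eq_single x]
      · simp [hf]
      · intro y _ hy; simp [hy]
      · simp
    rw [← h1, hω']
    simp only [featureMatrix, Pi.smul_apply (1 + u)⁻¹, smul_assoc (1 + u)⁻¹, ← Finset.smul_sum]
    rw [smul_inv_smul₀ hu1.ne']
  have hdet : (featureMatrix φ ω + u • vecMulVec f f).det =
      (featureMatrix φ ω).det * (1 + u * (f ⬝ᵥ (featureMatrix φ ω)⁻¹ *ᵥ f)) := by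
    rw [← smul_vecMulVec, vecMulVec_eq Unit,
      det_add_replicateCol_mul_replicateRow (isUnit_iff_ne_zero.2 hpos.ne')]
    congr 1
    rw [det_unique, ← replicateCol_mulVec, ← mulVec_mulVec, mulVec_smul, mulVec_smul]
    rfl
  have hle : (featureMatrix φ ω').det ≤ (featureMatrix φ ω).det := hmax hmem
  rw [hΛ, det_smul, Fintype.card_fin] at hdet
  have := mul_le_mul_of_nonneg_left hle (pow_nonneg hu1.le d)
  rw [hdet, mul_comm] at this
  exact le_of_mul_le_mul_right this hpos

end Design

/-! ### Bounds on the characteristic times -/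

namespace MDP

variable {S A : Type*} [Fintype S] [MeasurableSpace S] [DiscreteMeasurableSpace S]

/-- Over finitely many pairs some η bounds the Bellman difference, so `gap_add_le` makes the gap
finite. Thus an infinite gap leaves no alternatives. -/
theorem gap_ne_top_of_mem_alt [Finite A] {d : ℕ} {φ : S → A → EuclideanSpace ℝ (Fin d)}
    {γ ε : ℝ} (hγ0 : 0 < γ) (hγ1 : γ < 1) (hε : 0 ≤ ε) {M M' : MDP S A} {πopt : S → A}
    (hopt : M.IsOptimal γ πopt) (hM' : M' ∈ alt φ γ ε M) : M.gap γ πopt ≠ ∞ := by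
  obtain ⟨η, hη⟩ := (Set.finite_range fun x : S × A => |M.optQ γ x.1 x.2 - (M'.reward x.1 x.2 +
    γ * ∑ s', (M'.p x.1 x.2).real {s'} * M.optValue γ s')|).bddAbove
  have h := gap_add_le hγ0 hγ1 hε hopt (fun s a => hη ⟨(s, a), rfl⟩) hM'.2.2
  exact ne_top_of_le_ne_top ENNReal.ofReal_ne_top (le_self_add.trans h)

/-- The difference of the Bellman operators of two linear MDPs is linear in the features. -/
theorem exists_optQ_sub_eq_inner {d : ℕ} {φ : S → A → EuclideanSpace ℝ (Fin d)} {γ : ℝ}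
    {M M' : MDP S A} (hM : M ∈ linearMDPs φ) (hM' : M' ∈ linearMDPs φ) :
    ∃ w : EuclideanSpace ℝ (Fin d), ∀ s a, M.optQ γ s a -
      (M'.reward s a + γ * ∑ s', (M'.p s a).real {s'} * M.optValue γ s') = inner ℝ (φ s a) w := by
  obtain ⟨-, μ, θ, hp, hr⟩ := hM
  obtain ⟨-, μ', θ', hp', hr'⟩ := hM'
  refine ⟨θ - θ' + γ • ∑ s', M.optValue γ s' • (μ s' - μ' s'), fun s a => ?_⟩
  simp only [optQ, hp, hp', hr, hr', inner_add_right, inner_sub_right, inner_smul_right, inner_sum,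
    mul_sub, Finset.sum_sub_distrib]
  simp only [mul_comm (M.optValue γ _)]
  ring

theorem gap_add_sq_le_mul_sum_kl [Fintype A] {d : ℕ} {φ : S → A → EuclideanSpace ℝ (Fin d)}
    {γ ε : ℝ} (hγ0 : 0 < γ) (hγ1 : γ < 1) (hε : 0 ≤ ε) {M M' : MDP S A} (hM : M ∈ linearMDPs φ)
    {πopt : S → A} (hopt : M.IsOptimal γ πopt) (hM' : M' ∈ alt φ γ ε M) {ω : S × A → ℝ}
    (hω : ∀ x, 0 ≤ ω x) (hσ0 : designVariance φ ω ≠ 0) (hσ : designVariance φ ω ≠ ∞) :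
    3 * ENNReal.ofReal (1 - γ) ^ 4 * (M.gap γ πopt + ENNReal.ofReal ε) ^ 2 ≤
      10 * designVariance φ ω * ∑ x : S × A, ENNReal.ofReal (ω x) * M.kl M' x.1 x.2 := by
  set T := ∑ x : S × A, ENNReal.ofReal (ω x) * M.kl M' x.1 x.2
  by_cases hT : T = ∞
  · rw [hT, ENNReal.mul_top (mul_ne_zero (by norm_num) hσ0)]; exact le_top
  have hγ : 0 < 1 - γ := by linarith
  obtain ⟨w, hw⟩ := exists_optQ_sub_eq_inner (γ := γ) hM hM'.1
  have hinner : ∀ s a, inner ℝ (φ s a) w = (φ s a).ofLp ⬝ᵥ w.ofLp := fun s a => by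
    rw [EuclideanSpace.inner_eq_star_dotProduct, star_trivial, dotProduct_comm]
  set σ := (designVariance φ ω).toReal with hσr
  have hdet : (featureMatrix φ ω).det ≠ 0 := fun h => hσ (by simp [designVariance, h])
  have hK : ∑ x : S × A, ω x * (2 * (1 - γ) ^ 2 * ((φ x.1 x.2).ofLp ⬝ᵥ w.ofLp) ^ 2) ≤
      T.toReal := by
    rw [← ENNReal.ofReal_le_iff_le_toReal hT,
      ENNReal.ofReal_sum_of_nonneg fun x _ => mul_nonneg (hω x) (by positivity)]
    refine Finset.sum_le_sum fun x _ => ?_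
    rw [ENNReal.ofReal_mul (hω x)]
    gcongr
    rw [← hinner, ← hw]
    exact sq_optQ_sub_le_kl hγ0 hγ1 hM hM'.1 hM'.2.1 hopt x.1 x.2
  have hsq : ∀ s a, (inner ℝ (φ s a) w) ^ 2 ≤ σ * T.toReal / (2 * (1 - γ) ^ 2) := fun s a => by
    have h1 := sq_dotProduct_le_mul_sum φ hω hdet (φ s a).ofLp w.ofLp
    have h2 : (φ s a).ofLp ⬝ᵥ Matrix.mulVec (featureMatrix φ ω)⁻¹ (φ s a).ofLp ≤ σ := by
      rw [hσr, ← ENNReal.ofReal_le_iff_le_toReal hσ, designVariance, if_neg hdet]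
      exact le_iSup (fun x : S × A => ENNReal.ofReal
        ((φ x.1 x.2).ofLp ⬝ᵥ Matrix.mulVec (featureMatrix φ ω)⁻¹ (φ x.1 x.2).ofLp)) (s, a)
    rw [hinner, le_div_iff₀ (by positivity)]
    have h3 : ∑ x : S × A, ω x * (2 * (1 - γ) ^ 2 * ((φ x.1 x.2).ofLp ⬝ᵥ w.ofLp) ^ 2) =
        (∑ x : S × A, ω x * ((φ x.1 x.2).ofLp ⬝ᵥ w.ofLp) ^ 2) * (2 * (1 - γ) ^ 2) := by
      rw [Finset.sum_mul]
      exact Finset.sum_congr rfl fun x _ => by ring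
    rw [h3] at hK
    calc _ ≤ (σ * ∑ x : S × A, ω x * ((φ x.1 x.2).ofLp ⬝ᵥ w.ofLp) ^ 2) * (2 * (1 - γ) ^ 2) := by
          gcongr
          exact h1.trans (mul_le_mul_of_nonneg_right h2
            (Finset.sum_nonneg fun x _ => mul_nonneg (hω x) (sq_nonneg _)))
      _ ≤ _ := by
          rw [mul_assoc]
          exact mul_le_mul_of_nonneg_left hK ENNReal.toReal_nonneg
  have hgap := gap_add_le hγ0 hγ1 hε hopt
    (η := √(σ * T.toReal / (2 * (1 - γ) ^ 2)))
    (fun s a => by rw [hw]; exact Real.abs_le_sqrt (hsq s a)) hM'.2.2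
  have hσT : 0 ≤ σ * T.toReal := mul_nonneg ENNReal.toReal_nonneg ENNReal.toReal_nonneg
  have hη := Real.sq_sqrt (show 0 ≤ σ * T.toReal / (2 * (1 - γ) ^ 2) by positivity)
  set η := √(σ * T.toReal / (2 * (1 - γ) ^ 2))
  have hη0 : 0 ≤ η := Real.sqrt_nonneg _
  calc 3 * ENNReal.ofReal (1 - γ) ^ 4 * (M.gap γ πopt + ENNReal.ofReal ε) ^ 2
      ≤ ENNReal.ofReal 3 * ENNReal.ofReal (1 - γ) ^ 4 *
          ENNReal.ofReal (2 * η / (1 - γ)) ^ 2 := by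
        gcongr
        simp
    _ = ENNReal.ofReal (3 * (1 - γ) ^ 4 * (2 * η / (1 - γ)) ^ 2) := by
        rw [← ENNReal.ofReal_pow hγ.le, ← ENNReal.ofReal_pow (by positivity),
          ← ENNReal.ofReal_mul (by norm_num), ← ENNReal.ofReal_mul (by positivity)]
    _ ≤ ENNReal.ofReal (10 * σ * T.toReal) := by
        refine ENNReal.ofReal_le_ofReal ?_
        -- Here 3 · 4η²(1 - γ)² = 6σT, since η² = σT/(2(1 - γ)²).
        have : 3 * (1 - γ) ^ 4 * (2 * η / (1 - γ)) ^ 2 = 6 * (σ * T.toReal) := by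
          rw [div_pow, mul_pow, hη]
          field_simp
          ring
        rw [this]
        linarith
    _ = 10 * designVariance φ ω * T := by
        rw [ENNReal.ofReal_mul (by positivity), ENNReal.ofReal_mul (by norm_num),
          ENNReal.ofReal_toReal hσ, ENNReal.ofReal_toReal hT]
        simp

theorem charTime_le [Fintype A] {d : ℕ} {φ : S → A → EuclideanSpace ℝ (Fin d)}
    {γ ε : ℝ} (hγ0 : 0 < γ) (hγ1 : γ < 1) (hε : 0 ≤ ε) {M : MDP S A} (hM : M ∈ linearMDPs φ)
    {πopt : S → A} (hopt : M.IsOptimal γ πopt) {ω : S × A → ℝ}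
    (hω : ∀ x, 0 ≤ ω x) (hσ0 : designVariance φ ω ≠ 0) :
    charTime φ γ ε M ω ≤ 10 * designVariance φ ω /
      (3 * ENNReal.ofReal (1 - γ) ^ 4 * (M.gap γ πopt + ENNReal.ofReal ε) ^ 2) := by
  -- Without alternatives the infimum is ∞ and the characteristic time is 0.
  rcases (alt φ γ ε M).eq_empty_or_nonempty with hempty | ⟨M₁, hM₁⟩
  · simp [charTime, hempty]
  have hX : 3 * ENNReal.ofReal (1 - γ) ^ 4 * (M.gap γ πopt + ENNReal.ofReal ε) ^ 2 ≠ ∞ := by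
    have := gap_ne_top_of_mem_alt hγ0 hγ1 hε hopt hM₁
    finiteness
  have h10 : 10 * designVariance φ ω ≠ 0 := mul_ne_zero (by norm_num) hσ0
  by_cases hσ : designVariance φ ω = ∞
  · rw [hσ, ENNReal.mul_top (by norm_num), ENNReal.top_div_of_ne_top hX]
    exact le_top
  rw [charTime, ENNReal.inv_le_iff_inv_le, ENNReal.inv_div (.inl hX) (.inr h10)]
  exact le_iInf₂ fun M' hM' => ENNReal.div_le_of_le_mul'
    (gap_add_sq_le_mul_sum_kl hγ0 hγ1 hε hM hopt hM' hω hσ0 hσ)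

/-- A zero feature would make the transition probabilities sum to 0 instead of 1. -/
theorem feature_ne_zero {d : ℕ} {φ : S → A → EuclideanSpace ℝ (Fin d)} {M : MDP S A}
    (hM : M ∈ linearMDPs φ) (s : S) (a : A) : φ s a ≠ 0 := by
  intro h
  obtain ⟨-, μ, θ, hp, -⟩ := hM
  have := M.sum_p_real s a
  simp [hp, h] at this

end MDP

theorem mainTheorem5 {S A : Type*} [Fintype S] [Nonempty S] [MeasurableSpace S]
    [DiscreteMeasurableSpace S] [Fintype A] [Nonempty A] {d : ℕ}
    (φ : S → A → EuclideanSpace ℝ (Fin d))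
    (hφ : Submodule.span ℝ (Set.range fun x : S × A => φ x.1 x.2) = ⊤)
    (γ : ℝ) (hγ0 : 0 < γ) (hγ1 : γ < 1) (ε : ℝ) (hε : 0 ≤ ε)
    (M : MDP S A) (hM : M ∈ MDP.linearMDPs φ)
    (πopt : S → A) (hopt : M.IsOptimal γ πopt)
    (huniq : ∀ π : S → A, M.IsOptimal γ π → π = πopt) :
    (∀ ω ∈ stdSimplex ℝ (S × A),
      MDP.charTime φ γ ε M ω ≤
        10 * designVariance φ ω /
          (3 * ENNReal.ofReal (1 - γ) ^ 4 * (M.gap γ πopt + ENNReal.ofReal ε) ^ 2)) ∧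
    MDP.optCharTime φ γ ε M ≤
      10 * (d : ℝ≥0∞) /
        (3 * ENNReal.ofReal (1 - γ) ^ 4 * (M.gap γ πopt + ENNReal.ofReal ε) ^ 2) := by
  have hσ0 : ∀ ω ∈ stdSimplex ℝ (S × A), designVariance φ ω ≠ 0 := fun ω hω =>
    designVariance_ne_zero φ (MDP.feature_ne_zero hM (Classical.arbitrary S) (Classical.arbitrary A))
      hω.1
  have h1 := fun ω (hω : ω ∈ stdSimplex ℝ (S × A)) =>
    MDP.charTime_le hγ0 hγ1 hε hM hopt hω.1 (hσ0 ω hω)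
  refine ⟨h1, ?_⟩
  obtain ⟨ω, hω, hσ⟩ := exists_designVariance_le φ hφ
  calc MDP.optCharTime φ γ ε M ≤ MDP.charTime φ γ ε M ω := by
        rw [MDP.optCharTime, ENNReal.inv_le_iff_inv_le]
        exact le_iSup₂ (f := fun ω (_ : ω ∈ stdSimplex ℝ (S × A)) =>
          (MDP.charTime φ γ ε M ω)⁻¹) ω hω
    _ ≤ _ := h1 ω hω
    _ ≤ _ := by gcongr
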